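/- Let $\mathcal H$ be a finite-dimensional complex Hilbert space and let $\rho_0,\rho_1\in B(\mathcal H)$ be invertible density matrices (positive, of trace one). Let $M_0\subseteq B(\mathcal H)$ be a unital $*$-subalgebra, and let $E:B(\mathcal H)\to M_0$ be the trace-preserving conditional expectation, i.e. $E(A)$ is the unique element of $M_0$ with $\mathrm{Tr}\,E(A)X=\mathrm{Tr}\,AX$ for all $X\in M_0$. A test is an operator $M\in B(\mathcal H)$ with $0\le M\le 1$; its error probabilities are $\alpha(M)=\mathrm{Tr}\,\rho_0M$ and $\beta(M)=\mathrm{Tr}\,\rho_1(1-M)$. The subalgebra $M_0$ is called 2-sufficient for $\{\rho_0,\rho_1\}$ if for every test $M$ and every $\lambda\in(0,1)$ there is a test $N_\lambda\in M_0$ such that $$\lambda\alpha(N_\lambda)+(1-\lambda)\beta(N_\lambda)\le\lambda\alpha(M)+(1-\lambda)\beta(M).$$ It is called sufficient for $\{\rho_0,\rho_1\}$ if there is a completely positive trace-preserving linear map $T:M_0\to B(\mathcal H)$ with $T(E(\rho_0))=\rho_0$ and $T(E(\rho_1))=\rho_1$. **Theorem.** Let $M_0$ be 2-sufficient for $\{\rho_0,\rho_1\}$.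 Then $M_0$ is sufficient for $\{\rho_0,\rho_1\}$ in each of the following cases: 1. $\rho_0^{it}M_0\rho_0^{-it}\subseteq M_0$ for all $t\in\mathbb R$; 2. $M_0$ is commutative; 3. $\rho_0$ and $\rho_1$ commute. -/

import Mathlib

noncomputable section

open scoped CStarAlgebra

/-! ### Subalgebras of `B(H)`

`B(H)` is the C⋆-algebra `H →L[ℂ] H` with its Loewner order. A subalgebra is a unital `*`-subalgebra;
it carries the structure of a C⋆-algebra and the order of `B(H)`. -/

section Subalgebra

variable {H : Type*} [NormedAddCommGroup H] [InnerProductSpace ℂ H] [FiniteDimensional ℂ H]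
  [CompleteSpace H]

instance finiteDimensional_subalgebra (M₀ : StarSubalgebra ℂ (H →L[ℂ] H)) :
    FiniteDimensional ℂ M₀ :=
  inferInstanceAs (FiniteDimensional ℂ M₀.toSubalgebra.toSubmodule)

instance isClosed_subalgebra (M₀ : StarSubalgebra ℂ (H →L[ℂ] H)) :
    IsClosed (M₀ : Set (H →L[ℂ] H)) :=
  Submodule.closed_of_finiteDimensional M₀.toSubalgebra.toSubmodule

instance starOrderedRing_subalgebra (M₀ : StarSubalgebra ℂ (H →L[ℂ] H)) :
    StarOrderedRing M₀ := by
  refine StarOrderedRing.of_nonneg_iff' (fun {x y} hxy z => ?_) (fun x => ⟨fun hx => ?_, ?_⟩)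
  · exact add_le_add_right (α := H →L[ℂ] H) hxy z
  · have hx' : (0 : H →L[ℂ] H) ≤ (x : H →L[ℂ] H) := hx
    have hsa : IsSelfAdjoint x := Subtype.ext (IsSelfAdjoint.of_nonneg hx').star_eq
    have hsp : ∀ r ∈ spectrum ℝ x, 0 ≤ r := by
      intro r hr
      refine spectrum_nonneg_of_nonneg hx' (a := (x : H →L[ℂ] H)) ?_
      rw [spectrum.mem_iff] at hr ⊢
      intro h
      refine hr ((StarSubalgebra.coe_isUnit (S := M₀)).mp ?_)
      simpa [Algebra.algebraMap_eq_smul_one] using h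
    refine ⟨cfc Real.sqrt x, ?_⟩
    rw [(cfc_predicate Real.sqrt x : IsSelfAdjoint _).star_eq, ← cfc_mul ..]
    conv_lhs => rw [← cfc_id ℝ x]
    exact cfc_congr fun r hr => (Real.mul_self_sqrt (hsp r hr)).symm
  · rintro ⟨s, rfl⟩
    exact star_mul_self_nonneg (s : H →L[ℂ] H)

end Subalgebra

/-! ### Trace and restriction of densities -/

section Trace

variable {H : Type*} [NormedAddCommGroup H] [InnerProductSpace ℂ H] [FiniteDimensional ℂ H]
  [CompleteSpace H]

/-- The trace `Tr : B(H) → ℂ`. -/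
def opTrace : (H →L[ℂ] H) →ₗ[ℂ] ℂ :=
  LinearMap.trace ℂ H ∘ₗ ContinuousLinearMap.coeLM ℂ

theorem eq_zero_of_opTrace_star_mul_self (A : H →L[ℂ] H) (h : opTrace (star A * A) = 0) :
    A = 0 := by
  have h1 : opTrace (star A * A) =
      ∑ i, inner ℂ (stdOrthonormalBasis ℂ H i) ((star A * A) (stdOrthonormalBasis ℂ H i)) :=
    LinearMap.trace_eq_sum_inner ((star A * A : H →L[ℂ] H) : H →ₗ[ℂ] H) (stdOrthonormalBasis ℂ H)
  have h2 : ∀ i, inner ℂ (stdOrthonormalBasis ℂ H i)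
      ((star A * A) (stdOrthonormalBasis ℂ H i)) =
      ((‖A (stdOrthonormalBasis ℂ H i)‖ ^ 2 : ℝ) : ℂ) := by
    intro i
    rw [mul_apply_eq_comp, ContinuousLinearMap.star_eq_adjoint,
      ContinuousLinearMap.adjoint_inner_right, inner_self_eq_norm_sq_to_K]
    norm_cast
  rw [h1, Finset.sum_congr rfl fun i _ => h2 i, ← Complex.ofReal_sum, Complex.ofReal_eq_zero,
    Finset.sum_eq_zero_iff_of_nonneg fun i _ => sq_nonneg _] at h
  have h3 : (A : H →ₗ[ℂ] H) = 0 :=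
    (stdOrthonormalBasis ℂ H).toBasis.ext fun i => by simpa using h i (Finset.mem_univ i)
  exact ContinuousLinearMap.coe_injective h3

/-- The bilinear form `(X, Y) ↦ Tr (X Y)` on a subalgebra. -/
def subTraceForm (M₀ : StarSubalgebra ℂ (H →L[ℂ] H)) : LinearMap.BilinForm ℂ M₀ :=
  ((LinearMap.mul ℂ (H →L[ℂ] H)).compr₂ opTrace).compl₁₂
    M₀.subtype.toAlgHom.toLinearMap M₀.subtype.toAlgHom.toLinearMap

theorem subTraceForm_nondegenerate (M₀ : StarSubalgebra ℂ (H →L[ℂ] H)) :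
    (subTraceForm M₀).Nondegenerate := by
  refine ⟨fun X hX => ?_, fun X hX => ?_⟩
  · refine Subtype.ext (eq_zero_of_opTrace_star_mul_self (X : H →L[ℂ] H) ?_)
    exact (LinearMap.trace_mul_comm ℂ ((star X : M₀) : H →L[ℂ] H).toLinearMap
      (X : H →L[ℂ] H).toLinearMap).trans (hX (star X))
  · exact Subtype.ext (eq_zero_of_opTrace_star_mul_self (X : H →L[ℂ] H) (hX (star X)))

/-- The trace preserving conditional expectation `E : B(H) → M₀`: the element `E(A)` of `M₀` is
determined by `Tr (E(A) X) = Tr (A X)` for all `X ∈ M₀`. For a density `ρ`, `E(ρ)` is the density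
of the restriction to `M₀` of the state given by `ρ`. -/
def condExpTr (M₀ : StarSubalgebra ℂ (H →L[ℂ] H)) : (H →L[ℂ] H) →ₗ[ℂ] M₀ :=
  ((subTraceForm M₀).toDual (subTraceForm_nondegenerate M₀)).symm.toLinearMap ∘ₗ
    ((LinearMap.mul ℂ (H →L[ℂ] H)).compr₂ opTrace).compl₂ M₀.subtype.toAlgHom.toLinearMap

theorem opTrace_condExpTr_mul (M₀ : StarSubalgebra ℂ (H →L[ℂ] H)) (A : H →L[ℂ] H) (X : M₀) :
    opTrace ((condExpTr M₀ A : H →L[ℂ] H) * (X : H →L[ℂ] H)) = opTrace (A * (X : H →L[ℂ] H)) :=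
  LinearMap.BilinForm.apply_toDual_symm_apply (B := subTraceForm M₀)
    (hB := subTraceForm_nondegenerate M₀)
    (((LinearMap.mul ℂ (H →L[ℂ] H)).compr₂ opTrace).compl₂ M₀.subtype.toAlgHom.toLinearMap A) X

theorem condExpTr_unique (M₀ : StarSubalgebra ℂ (H →L[ℂ] H)) (A : H →L[ℂ] H) (Y : M₀)
    (h : ∀ X : M₀, opTrace ((Y : H →L[ℂ] H) * (X : H →L[ℂ] H)) = opTrace (A * (X : H →L[ℂ] H))) :
    Y = condExpTr M₀ A := by
  refine ((subTraceForm M₀).toDual (subTraceForm_nondegenerate M₀)).injective (LinearMap.ext fun X => ?_)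
  exact (h X).trans (opTrace_condExpTr_mul M₀ A X).symm

end Trace

/-! ### States, tests and sufficiency -/

section Testing

variable {H : Type*} [NormedAddCommGroup H] [InnerProductSpace ℂ H] [FiniteDimensional ℂ H]
  [CompleteSpace H]

/-- An invertible density matrix (the density of a faithful state). -/
structure IsInvertibleDensity (ρ : H →L[ℂ] H) : Prop where
  nonneg : 0 ≤ ρ
  trace_eq_one : opTrace ρ = 1
  isUnit : IsUnit ρ

/-- A test is an operator `0 ≤ M ≤ 1`. -/
def IsTest (M : H →L[ℂ] H) : Prop := 0 ≤ M ∧ M ≤ 1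

/-- Error probability of the first kind, `α(M) = Tr (ρ₀ M)`. -/
def errorFirst (ρ₀ M : H →L[ℂ] H) : ℝ := (opTrace (ρ₀ * M)).re

/-- Error probability of the second kind, `β(M) = Tr (ρ₁ (1 - M))`. -/
def errorSecond (ρ₁ M : H →L[ℂ] H) : ℝ := (opTrace (ρ₁ * (1 - M))).re

/-- The Bayes error probability `r α(M) + (1 - r) β(M)` for the prior `(r, 1 - r)`. -/
def bayesError (ρ₀ ρ₁ : H →L[ℂ] H) (r : ℝ) (M : H →L[ℂ] H) : ℝ :=
  r * errorFirst ρ₀ M + (1 - r) * errorSecond ρ₁ M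

/-- `M₀` is 2-sufficient for `{ρ₀, ρ₁}`: for every prior, any test is matched or improved by a
test in `M₀`. -/
def IsTwoSufficient (M₀ : StarSubalgebra ℂ (H →L[ℂ] H)) (ρ₀ ρ₁ : H →L[ℂ] H) : Prop :=
  ∀ M : H →L[ℂ] H, IsTest M → ∀ r ∈ Set.Ioo (0 : ℝ) 1,
    ∃ N ∈ M₀, IsTest N ∧ bayesError ρ₀ ρ₁ r N ≤ bayesError ρ₀ ρ₁ r M

/-- `M₀` is sufficient for `{ρ₀, ρ₁}`: some completely positive trace preserving map
`T : M₀ → B(H)` maps both restricted densities to the original ones. -/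
def IsSufficient (M₀ : StarSubalgebra ℂ (H →L[ℂ] H)) (ρ₀ ρ₁ : H →L[ℂ] H) : Prop :=
  ∃ T : M₀ →CP (H →L[ℂ] H),
    (∀ X : M₀, opTrace (T X) = opTrace (X : H →L[ℂ] H)) ∧
    T (condExpTr M₀ ρ₀) = ρ₀ ∧ T (condExpTr M₀ ρ₁) = ρ₁

/-- The power `ρ ^ z = exp (z log ρ)` of an invertible positive operator `ρ`. -/
def opCpow (ρ : H →L[ℂ] H) (z : ℂ) : H →L[ℂ] H := NormedSpace.exp (z • CFC.log ρ)

/-- Invariance under the modular group: `ρ ^ (it) M₀ ρ ^ (-it) ⊆ M₀` for all real `t`. -/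
def IsModularInvariant (M₀ : StarSubalgebra ℂ (H →L[ℂ] H)) (ρ : H →L[ℂ] H) : Prop :=
  ∀ t : ℝ, ∀ X ∈ M₀, opCpow ρ (Complex.I * t) * X * opCpow ρ (-(Complex.I * t)) ∈ M₀

end Testing

end

open scoped CStarAlgebra

section

open Filter Topology

variable {H : Type*} [NormedAddCommGroup H] [InnerProductSpace ℂ H] [FiniteDimensional ℂ H]
  [CompleteSpace H]

set_option linter.unusedSectionVars false

/-! Put `A_s = ρ₁ - s ρ₀`. By the Neyman-Pearson argument, 2-sufficiency places in `M₀` a test `N`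
with `A_s N = A_s⁺`, for every `s > 0`. Letting `s` tend to `t` from below and from above gives two
such tests for `A_t`, one acting as `1` and the other as `0` on `ker A_t`. Their difference `D ∈ M₀`
satisfies `A_t D = 0`, so `E(A_t) D = 0`, and `E(A_t)` vanishes on `ker A_t`
(`IsTwoSufficient.condExpTr_apply_eq`). The kernels `ker A_t`, `t > 0`, span `H`; hence `ρ₀⁻¹ρ₁ =
E(ρ₀)⁻¹E(ρ₁) =: a ∈ M₀` (`IsTwoSufficient.exists_ratio`).

If `M₀` is commutative, or the densities commute, then `a` commutes with `ρ₀` and the Petz map of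
`ρ₀` recovers both densities (`isSufficient_of_commute_ratio`). Under modular invariance, `c =
E(ρ₀)⁻¹ρ₀` is positive and commutes with `M₀`, and the recovery map is `X ↦ X c`
(`isSufficient_of_isModularInvariant`). -/

/-! ### Positivity of the trace -/

theorem opTrace_mul_comm (A B : H →L[ℂ] H) : opTrace (A * B) = opTrace (B * A) :=
  LinearMap.trace_mul_comm ℂ A.toLinearMap B.toLinearMap

theorem opTrace_star (A : H →L[ℂ] H) : opTrace (star A) = star (opTrace A) := by
  have h (B : H →L[ℂ] H) : opTrace B =
      ∑ i, inner ℂ (stdOrthonormalBasis ℂ H i) (B (stdOrthonormalBasis ℂ H i)) :=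
    LinearMap.trace_eq_sum_inner (B : H →ₗ[ℂ] H) (stdOrthonormalBasis ℂ H)
  rw [h, h, star_sum]
  refine Finset.sum_congr rfl fun i _ => ?_
  rw [ContinuousLinearMap.star_eq_adjoint, ContinuousLinearMap.adjoint_inner_right]
  exact (inner_conj_symm _ _).symm

theorem re_opTrace_nonneg {A : H →L[ℂ] H} (hA : 0 ≤ A) : 0 ≤ (opTrace A).re := by
  have h := ((ContinuousLinearMap.nonneg_iff_isPositive A).mp hA).toLinearMap.trace_nonneg
  exact (Complex.le_def.mp h).1

theorem opTrace_eq_re {A : H →L[ℂ] H} (hA : IsSelfAdjoint A) : opTrace A = (opTrace A).re := by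
  have h := opTrace_star A
  rw [hA.star_eq] at h
  exact (Complex.conj_eq_iff_re.mp h.symm).symm

theorem exists_star_mul_self {A : H →L[ℂ] H} (hA : 0 ≤ A) : ∃ S, star S * S = A := by
  obtain ⟨S, hS⟩ := CStarAlgebra.nonneg_iff_eq_star_mul_self.mp hA
  exact ⟨S, hS.symm⟩

theorem opTrace_mul_eq_of_star_mul_self (S R : H →L[ℂ] H) :
    opTrace (star S * S * (star R * R)) = opTrace (star (R * star S) * (R * star S)) := by
  rw [star_mul, star_star, mul_assoc, opTrace_mul_comm]
  simp only [mul_assoc]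

theorem re_opTrace_mul_nonneg {A B : H →L[ℂ] H} (hA : 0 ≤ A) (hB : 0 ≤ B) :
    0 ≤ (opTrace (A * B)).re := by
  obtain ⟨S, rfl⟩ := exists_star_mul_self hA
  obtain ⟨R, rfl⟩ := exists_star_mul_self hB
  rw [opTrace_mul_eq_of_star_mul_self]
  exact re_opTrace_nonneg (star_mul_self_nonneg _)

/-- For `A = S⋆S` and `B = R⋆R`, the trace of `A B` is the squared Hilbert-Schmidt norm of `R S⋆`.
-/
theorem mul_eq_zero_of_re_opTrace_mul {A B : H →L[ℂ] H} (hA : 0 ≤ A) (hB : 0 ≤ B)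
    (h : (opTrace (A * B)).re = 0) : A * B = 0 := by
  obtain ⟨S, rfl⟩ := exists_star_mul_self hA
  obtain ⟨R, rfl⟩ := exists_star_mul_self hB
  rw [opTrace_mul_eq_of_star_mul_self] at h
  have h0 : R * star S = 0 := by
    refine eq_zero_of_opTrace_star_mul_self _ ?_
    rw [opTrace_eq_re (IsSelfAdjoint.star_mul_self _), h, Complex.ofReal_zero]
  have h1 : S * star R = 0 := by simpa using congrArg star h0
  rw [mul_assoc, ← mul_assoc S, h1, zero_mul, mul_zero]

/-! ### The conditional expectation -/

theorem condExpTr_mul_right (M₀ : StarSubalgebra ℂ (H →L[ℂ] H)) (A : H →L[ℂ] H) (Y : M₀) :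
    condExpTr M₀ (A * Y) = condExpTr M₀ A * Y := by
  refine (condExpTr_unique M₀ _ _ fun X => ?_).symm
  have h := opTrace_condExpTr_mul M₀ A (Y * X)
  simpa [mul_assoc] using h

theorem condExpTr_mul_left (M₀ : StarSubalgebra ℂ (H →L[ℂ] H)) (A : H →L[ℂ] H) (Y : M₀) :
    condExpTr M₀ (Y * A) = Y * condExpTr M₀ A := by
  refine (condExpTr_unique M₀ _ _ fun X => ?_).symm
  have h := opTrace_condExpTr_mul M₀ A (X * Y)
  rw [MulMemClass.coe_mul, mul_assoc, opTrace_mul_comm, mul_assoc, ← MulMemClass.coe_mul, h,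
    MulMemClass.coe_mul, ← mul_assoc, opTrace_mul_comm, mul_assoc]

theorem star_condExpTr (M₀ : StarSubalgebra ℂ (H →L[ℂ] H)) (A : H →L[ℂ] H) :
    star (condExpTr M₀ A) = condExpTr M₀ (star A) := by
  refine condExpTr_unique M₀ _ _ fun X => ?_
  have h := congrArg star (opTrace_condExpTr_mul M₀ A (star X))
  rw [← opTrace_star, ← opTrace_star, star_mul, star_mul] at h
  rw [opTrace_mul_comm, opTrace_mul_comm (star A)]
  simpa using h

/-- Pairing `F = E(A)` with `F⁻ ∈ M₀` gives `-Tr (F⁻)² = Tr (A F⁻) ≥ 0`, which forces `F⁻ = 0`. -/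
theorem condExpTr_nonneg (M₀ : StarSubalgebra ℂ (H →L[ℂ] H)) {A : H →L[ℂ] H} (hA : 0 ≤ A) :
    0 ≤ condExpTr M₀ A := by
  set F := condExpTr M₀ A with hF
  have hsa : IsSelfAdjoint F := by
    rw [IsSelfAdjoint, hF, star_condExpTr, (IsSelfAdjoint.of_nonneg hA).star_eq]
  have hneg : (0 : M₀) ≤ F⁻ := CFC.negPart_nonneg F
  have h1 := opTrace_condExpTr_mul M₀ A F⁻
  have h2 : F * F⁻ = -(star F⁻ * F⁻) := by
    calc F * F⁻ = (F⁺ - F⁻) * F⁻ := by rw [CFC.posPart_sub_negPart F hsa]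
      _ = _ := by
        rw [sub_mul, CFC.posPart_mul_negPart, zero_sub, (IsSelfAdjoint.of_nonneg hneg).star_eq]
  have h3 := re_opTrace_mul_nonneg hA (B := ((F⁻ : M₀) : H →L[ℂ] H)) hneg
  rw [← h1, ← hF, ← MulMemClass.coe_mul, h2] at h3
  have h4 : 0 ≤ (opTrace (star ((F⁻ : M₀) : H →L[ℂ] H) * ((F⁻ : M₀) : H →L[ℂ] H))).re :=
    re_opTrace_nonneg (star_mul_self_nonneg _)
  have h5 : F⁻ = 0 := by
    refine Subtype.ext (eq_zero_of_opTrace_star_mul_self _ ?_)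
    rw [opTrace_eq_re (IsSelfAdjoint.star_mul_self _)]
    simp only [NegMemClass.coe_neg, map_neg, Complex.neg_re, MulMemClass.coe_mul,
      StarMemClass.coe_star] at h3
    exact_mod_cast le_antisymm (by linarith) h4
  rw [← CFC.posPart_sub_negPart F hsa, h5, sub_zero]
  exact CFC.posPart_nonneg F

/-- If `E(A) X = 0` then `Tr (A X X⋆) = 0`, so `A X X⋆ = 0` and `X = 0`; in finite dimension,
injectivity of left multiplication yields an inverse. -/
theorem isUnit_condExpTr (M₀ : StarSubalgebra ℂ (H →L[ℂ] H)) {A : H →L[ℂ] H} (hA : 0 ≤ A)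
    (hu : IsUnit A) : IsUnit (condExpTr M₀ A) := by
  set F := condExpTr M₀ A with hF
  have hsa : star F = F := (IsSelfAdjoint.of_nonneg (condExpTr_nonneg M₀ hA)).star_eq
  have hinj : Function.Injective (LinearMap.mulLeft ℂ F) := by
    refine (injective_iff_map_eq_zero _).mpr fun X hX => ?_
    have h1 := opTrace_condExpTr_mul M₀ A (X * star X)
    have h2 : F * X = 0 := hX
    rw [← MulMemClass.coe_mul, ← hF, ← mul_assoc, h2, zero_mul, ZeroMemClass.coe_zero,
      map_zero] at h1
    have h3 := mul_eq_zero_of_re_opTrace_mul hA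
      (B := ((X * star X : M₀) : H →L[ℂ] H)) (mul_star_self_nonneg (X : H →L[ℂ] H))
      (by rw [← h1, Complex.zero_re])
    rw [hu.mul_right_eq_zero] at h3
    exact Subtype.ext (CStarRing.mul_star_self_eq_zero_iff _ |>.mp h3)
  obtain ⟨Y, hY⟩ := LinearMap.injective_iff_surjective.mp hinj 1
  have hY : F * Y = 1 := hY
  have hY' : star Y * F = 1 := by simpa [hsa] using congrArg star hY
  exact isUnit_iff_exists.mpr ⟨Y, hY, by rwa [left_inv_eq_right_inv hY' hY] at hY'⟩

/-! ### Completely positive maps by conjugation -/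

/-- The completely positive map `X ↦ S X S⋆` on a subalgebra. -/
noncomputable def conjCP (M₀ : StarSubalgebra ℂ (H →L[ℂ] H)) (S : H →L[ℂ] H) : M₀ →CP (H →L[ℂ] H) where
  toLinearMap := (LinearMap.mulLeftRight ℂ (S, star S)) ∘ₗ M₀.subtype.toAlgHom.toLinearMap
  map_cstarMatrix_nonneg' k M hM := by
    have h1 : 0 ≤ M.map M₀.subtype :=
      NonUnitalStarAlgHomClass.instCompletelyPositiveMapClass.map_cstarMatrix_nonneg' _ k M hM
    let D : CStarMatrix (Fin k) (Fin k) (H →L[ℂ] H) :=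
      CStarMatrix.ofMatrix (Matrix.diagonal fun _ => S)
    refine le_of_le_of_eq (star_right_conjugate_nonneg h1 D) ?_
    ext i j : 2
    simp [D, CStarMatrix.mul_apply, CStarMatrix.star_apply, Matrix.diagonal_apply, apply_ite star]

theorem conjCP_apply (M₀ : StarSubalgebra ℂ (H →L[ℂ] H)) (S : H →L[ℂ] H) (X : M₀) :
    conjCP M₀ S X = S * (X : H →L[ℂ] H) * star S := rfl

theorem isSufficient_of_conj {M₀ : StarSubalgebra ℂ (H →L[ℂ] H)} {ρ₀ ρ₁ : H →L[ℂ] H}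
    (S : H →L[ℂ] H) (hS : ∀ X : M₀, opTrace (star S * S * (X : H →L[ℂ] H)) = opTrace (X : H →L[ℂ] H))
    (h₀ : S * (condExpTr M₀ ρ₀ : H →L[ℂ] H) * star S = ρ₀) (h₁ : S * (condExpTr M₀ ρ₁ : H →L[ℂ] H) * star S = ρ₁) :
    IsSufficient M₀ ρ₀ ρ₁ := by
  refine ⟨conjCP M₀ S, fun X => ?_, h₀, h₁⟩
  rw [← hS X, mul_assoc, opTrace_mul_comm, conjCP_apply]

/-! ### Bayes optimal tests -/

theorem isTest_starProjection (U : Submodule ℂ H) : IsTest U.starProjection := by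
  have h : IsStarProjection U.starProjection := isStarProjection_starProjection
  exact ⟨h.nonneg, h.le_one⟩

/-- The range projection of `A⁺` is the Neyman-Pearson test: it attains the maximum `Tr A⁺` of `Tr
(A M)` over tests. -/
theorem mul_starProjection_range_posPart {A : H →L[ℂ] H} (hA : IsSelfAdjoint A) :
    A * (A⁺).range.starProjection = A⁺ := by
  set P := (A⁺).range.starProjection with hP
  have hPs : star P = P := (isStarProjection_starProjection (U := (A⁺).range)).isSelfAdjoint
  have h1 : P * A⁺ = A⁺ := by
    ext x
    exact Submodule.starProjection_eq_self_iff.mpr ⟨x, rfl⟩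
  have h2 : P * A⁻ = 0 := by
    ext x
    refine (Submodule.starProjection_apply_eq_zero_iff _).mpr ?_
    rintro _ ⟨z, rfl⟩
    change inner ℂ (A⁺ z) (A⁻ x) = 0
    rw [← ContinuousLinearMap.adjoint_inner_left, ← ContinuousLinearMap.star_eq_adjoint,
      (IsSelfAdjoint.of_nonneg (CFC.negPart_nonneg A)).star_eq]
    have h3 : (A⁻ * A⁺) z = 0 := by rw [CFC.negPart_mul_posPart]; rfl
    rw [show A⁻ (A⁺ z) = 0 from h3, inner_zero_left]
  have h3 : P * A = A⁺ := by
    calc P * A = P * (A⁺ - A⁻) := by rw [CFC.posPart_sub_negPart A hA]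
      _ = _ := by rw [mul_sub, h1, h2, sub_zero]
  have h4 := congrArg star h3
  rwa [star_mul, hPs, hA.star_eq, (IsSelfAdjoint.of_nonneg (CFC.posPart_nonneg A)).star_eq] at h4

/-- The deficit `Tr A⁺ - Tr (A N)` equals `Tr (A⁺ (1 - N)) + Tr (A⁻ N)`; at an optimal test both
nonnegative terms vanish, hence so do both products. -/
theorem mul_eq_posPart_of_isTest {A N : H →L[ℂ] H} (hA : IsSelfAdjoint A) (hN : IsTest N)
    (h : (opTrace A⁺).re ≤ (opTrace (A * N)).re) : A * N = A⁺ := by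
  have hN' : 0 ≤ 1 - N := sub_nonneg.mpr hN.2
  have h1 := re_opTrace_mul_nonneg (CFC.posPart_nonneg A) hN'
  have h2 := re_opTrace_mul_nonneg (CFC.negPart_nonneg A) hN.1
  have h3 : A * N = A⁺ * N - A⁻ * N := by rw [← sub_mul, CFC.posPart_sub_negPart A hA]
  have h4 : A⁺ * (1 - N) = A⁺ - A⁺ * N := by rw [mul_sub, mul_one]
  have h5 := congrArg (fun X => (opTrace X).re) h3
  have h6 := congrArg (fun X => (opTrace X).re) h4
  simp only [map_sub, Complex.sub_re] at h5 h6
  have h7 := mul_eq_zero_of_re_opTrace_mul (CFC.posPart_nonneg A) hN' (by linarith)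
  have h8 := mul_eq_zero_of_re_opTrace_mul (CFC.negPart_nonneg A) hN.1 (by linarith)
  rw [h3, h8, sub_zero]
  rw [h4, sub_eq_zero] at h7
  exact h7.symm

theorem isSelfAdjoint_sub_smul {ρ₀ ρ₁ : H →L[ℂ] H} (h₀ : IsSelfAdjoint ρ₀)
    (h₁ : IsSelfAdjoint ρ₁) (s : ℝ) : IsSelfAdjoint (ρ₁ - (s : ℂ) • ρ₀) := by
  simp [IsSelfAdjoint, h₀.star_eq, h₁.star_eq]

/-- The prior `s / (1 + s)` turns minimising the Bayes error into maximising `Tr ((ρ₁ - s ρ₀) M)`.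
-/
theorem bayesError_eq (ρ₀ ρ₁ M : H →L[ℂ] H) {s : ℝ} (hs : 0 < s) :
    (1 + s) * bayesError ρ₀ ρ₁ (s / (1 + s)) M =
      (opTrace ρ₁).re - (opTrace ((ρ₁ - (s : ℂ) • ρ₀) * M)).re := by
  simp only [bayesError, errorFirst, errorSecond, mul_sub, sub_mul, map_sub, mul_one, map_smul,
    smul_mul_assoc, Complex.sub_re, smul_eq_mul, Complex.re_ofReal_mul]
  field_simp
  ring

theorem IsTwoSufficient.exists_isTest_mul_eq_posPart {M₀ : StarSubalgebra ℂ (H →L[ℂ] H)}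
    {ρ₀ ρ₁ : H →L[ℂ] H} (h2 : IsTwoSufficient M₀ ρ₀ ρ₁) (h₀ : IsSelfAdjoint ρ₀)
    (h₁ : IsSelfAdjoint ρ₁) {s : ℝ} (hs : 0 < s) :
    ∃ N ∈ M₀, IsTest N ∧ (ρ₁ - (s : ℂ) • ρ₀) * N = (ρ₁ - (s : ℂ) • ρ₀)⁺ := by
  have hA := isSelfAdjoint_sub_smul h₀ h₁ s
  obtain ⟨N, hNM, hN, hle⟩ := h2 _ (isTest_starProjection ((ρ₁ - (s : ℂ) • ρ₀)⁺).range)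
    (s / (1 + s)) ⟨by positivity, (div_lt_one (by positivity)).mpr (by linarith)⟩
  refine ⟨N, hNM, hN, mul_eq_posPart_of_isTest hA hN ?_⟩
  have h := mul_le_mul_of_nonneg_left hle (by positivity : 0 ≤ 1 + s)
  rw [bayesError_eq _ _ _ hs, bayesError_eq _ _ _ hs, mul_starProjection_range_posPart hA] at h
  linarith

/-! ### Limits of optimal tests -/

theorem isCompact_isTest (M₀ : StarSubalgebra ℂ (H →L[ℂ] H)) :
    IsCompact {N : H →L[ℂ] H | N ∈ M₀ ∧ IsTest N} := by
  have : ProperSpace (H →L[ℂ] H) := FiniteDimensional.proper ℂ _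
  refine Metric.isCompact_of_isClosed_isBounded ?_ ?_
  · exact (isClosed_subalgebra M₀).inter (isClosed_Icc (a := (0 : H →L[ℂ] H)) (b := 1))
  · refine (Metric.isBounded_iff_subset_closedBall 0).mpr ⟨1, fun N hN => ?_⟩
    rw [mem_closedBall_zero_iff]
    exact CStarAlgebra.norm_le_one_iff_of_nonneg N hN.2.1 |>.mpr hN.2.2

theorem re_inner_nonneg_of_nonneg {A : H →L[ℂ] H} (hA : 0 ≤ A) (x : H) :
    0 ≤ (inner ℂ (A x) x).re :=
  ((ContinuousLinearMap.nonneg_iff_isPositive A).mp hA).re_inner_nonneg_left x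

theorem sub_smul_apply_of_apply_eq_zero {ρ₀ ρ₁ : H →L[ℂ] H} {t s : ℝ} {x : H}
    (hx : (ρ₁ - (t : ℂ) • ρ₀) x = 0) :
    (ρ₁ - (s : ℂ) • ρ₀) x = ((t - s : ℝ) : ℂ) • ρ₀ x := by
  have h : ρ₁ x = (t : ℂ) • ρ₀ x := sub_eq_zero.mp hx
  simp [h, sub_smul]

/-- A limit of Bayes optimal tests along priors corresponding to `s k → t`. -/
theorem IsTwoSufficient.exists_limit_isTest {M₀ : StarSubalgebra ℂ (H →L[ℂ] H)}
    {ρ₀ ρ₁ : H →L[ℂ] H} (h2 : IsTwoSufficient M₀ ρ₀ ρ₁) (h₀ : IsSelfAdjoint ρ₀)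
    (h₁ : IsSelfAdjoint ρ₁) {t : ℝ} {s : ℕ → ℝ} (hs : ∀ k, 0 < s k)
    (hst : Tendsto s atTop (𝓝 t)) :
    ∃ N ∈ M₀, IsTest N ∧ (ρ₁ - (t : ℂ) • ρ₀) * N = (ρ₁ - (t : ℂ) • ρ₀)⁺ ∧
      ((∀ k, s k < t) → ∀ x, (ρ₁ - (t : ℂ) • ρ₀) x = 0 →
        (inner ℂ ((1 - N) x) (ρ₀ x)).re ≤ 0) ∧
      ((∀ k, t < s k) → ∀ x, (ρ₁ - (t : ℂ) • ρ₀) x = 0 →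
        (inner ℂ (N x) (ρ₀ x)).re ≤ 0) := by
  choose N hNM hN hNA using fun k => h2.exists_isTest_mul_eq_posPart h₀ h₁ (hs k)
  obtain ⟨L, hL, φ, hφ, hlim⟩ := (isCompact_isTest M₀).tendsto_subseq
    (x := N) fun k => ⟨hNM k, hN k⟩
  have hA : Tendsto (fun k => ρ₁ - ((s (φ k) : ℝ) : ℂ) • ρ₀) atTop (𝓝 (ρ₁ - (t : ℂ) • ρ₀)) :=
    tendsto_const_nhds.sub (((Complex.continuous_ofReal.tendsto t).comp
      (hst.comp hφ.tendsto_atTop)).smul_const ρ₀)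
  have hAN := hA.mul hlim
  have hsa (k) := isSelfAdjoint_sub_smul h₀ h₁ (s k)
  have hneg (k) : (ρ₁ - (s k : ℂ) • ρ₀) * N k - (ρ₁ - (s k : ℂ) • ρ₀) =
      (ρ₁ - (s k : ℂ) • ρ₀)⁻ := by
    conv_lhs => rw [hNA k]
    exact sub_eq_of_eq_add' (eq_add_of_sub_eq (CFC.posPart_sub_negPart _ (hsa k)))
  -- On `ker A_t` the operator `A_s` is `(t - s) ρ₀`, so the side from which `s` approaches `t`
  -- fixes the sign of the inequality on the kernel.
  have hx (k) {x : H} (hx : (ρ₁ - (t : ℂ) • ρ₀) x = 0) (X : H →L[ℂ] H) :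
      (inner ℂ (((ρ₁ - (s k : ℂ) • ρ₀) * X) x) x).re = (t - s k) * (inner ℂ (X x) (ρ₀ x)).re := by
    rw [mul_apply_eq_comp, ← ContinuousLinearMap.adjoint_inner_right,
      ← ContinuousLinearMap.star_eq_adjoint, (hsa k).star_eq,
      sub_smul_apply_of_apply_eq_zero hx, inner_smul_right, Complex.re_ofReal_mul]
  have hev (y z : H) : Tendsto (fun k => (inner ℂ (N (φ k) y) z).re) atTop
      (𝓝 (inner ℂ (L y) z).re) := by
    have : Continuous fun X : H →L[ℂ] H => (inner ℂ (X y) z).re := by fun_prop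
    exact (this.tendsto L).comp hlim
  refine ⟨L, hL.1, hL.2, ?_, fun hlt x hx0 => ?_, fun hlt x hx0 => ?_⟩
  -- `A_s N` and `A_s N - A_s` are positive with product zero; these conditions are closed and
  -- characterise the two parts of the limit.
  · refine (CFC.posPart_negPart_unique (a := ρ₁ - (t : ℂ) • ρ₀)
      (c := (ρ₁ - (t : ℂ) • ρ₀) * L - (ρ₁ - (t : ℂ) • ρ₀)) (by abel) ?_ ?_ ?_).1.symm
    · refine tendsto_nhds_unique (hAN.mul (hAN.sub hA)) (tendsto_const_nhds.congr fun k => ?_)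
      simp only [Function.comp]
      rw [hneg, hNA, CFC.posPart_mul_negPart]
    · refine ge_of_tendsto' hAN fun k => ?_
      simp only [Function.comp]
      rw [hNA]
      exact CFC.posPart_nonneg _
    · refine ge_of_tendsto' (hAN.sub hA) fun k => ?_
      simp only [Function.comp]
      rw [hneg]
      exact CFC.negPart_nonneg _
  · have hk (k) : (inner ℂ ((1 - N k) x) (ρ₀ x)).re ≤ 0 := by
      have h := re_inner_nonneg_of_nonneg (CFC.negPart_nonneg (ρ₁ - (s k : ℂ) • ρ₀)) x
      rw [← hneg, show (ρ₁ - (s k : ℂ) • ρ₀) * N k - (ρ₁ - (s k : ℂ) • ρ₀) =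
        (ρ₁ - (s k : ℂ) • ρ₀) * (-(1 - N k)) by rw [neg_sub, mul_sub, mul_one], hx k hx0] at h
      have h' := nonneg_of_mul_nonneg_right h (sub_pos.mpr (hlt k))
      rw [neg_apply, inner_neg_left, Complex.neg_re] at h'
      linarith
    have h := (hev x (ρ₀ x)).const_sub (inner ℂ x (ρ₀ x)).re
    have := le_of_tendsto' h (b := 0) fun k => by simpa [inner_sub_left] using hk (φ k)
    simpa [inner_sub_left] using this
  · have hk (k) : (inner ℂ (N k x) (ρ₀ x)).re ≤ 0 := by
      have h := re_inner_nonneg_of_nonneg (CFC.posPart_nonneg (ρ₁ - (s k : ℂ) • ρ₀)) x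
      rw [← hNA, hx k hx0] at h
      exact nonpos_of_mul_nonneg_right h (sub_neg.mpr (hlt k))
    exact le_of_tendsto' (hev x (ρ₀ x)) fun k => hk (φ k)

/-! ### Generalized eigenvectors of the two densities -/

theorem re_inner_pos {ρ : H →L[ℂ] H} (hρ : 0 ≤ ρ) (hu : IsUnit ρ) {x : H} (hx : x ≠ 0) :
    0 < (inner ℂ x (ρ x)).re := by
  obtain ⟨S, rfl⟩ := exists_star_mul_self hρ
  rw [mul_apply_eq_comp, ContinuousLinearMap.star_eq_adjoint,
    ContinuousLinearMap.adjoint_inner_right]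
  have h : S x ≠ 0 := by
    intro h0
    obtain ⟨Y, hY⟩ := hu.exists_left_inv
    apply hx
    have := congrArg (fun X : H →L[ℂ] H => X x) hY
    simpa [h0] using this.symm
  change 0 < RCLike.re (inner ℂ (S x) (S x))
  rw [inner_self_eq_norm_sq]
  exact pow_pos (norm_pos_iff.mpr h) 2

/-- `K` need not commute with `ρ`, so it is diagonalised on `ker A`, which it preserves: an
eigenvalue `μ ≥ 0` with `μ ⟨v, ρ v⟩ ≤ 0` is zero. -/
theorem apply_eq_zero_of_re_inner_nonpos {ρ A K : H →L[ℂ] H} (hρ : 0 ≤ ρ) (hu : IsUnit ρ)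
    (hK : 0 ≤ K) (hAK : Commute A K)
    (h : ∀ x, A x = 0 → (inner ℂ (K x) (ρ x)).re ≤ 0) {x : H} (hx : A x = 0) : K x = 0 := by
  set V : Submodule ℂ H := A.ker
  have hV : ∀ v ∈ V, (K : H →ₗ[ℂ] H) v ∈ V := by
    intro v hv
    have h1 := congrArg (fun X : H →L[ℂ] H => X v) hAK.eq
    have hv : A v = 0 := hv
    change A (K v) = 0
    simpa [hv] using h1
  have hsym : ((K : H →ₗ[ℂ] H).restrict hV).IsSymmetric :=
    ((ContinuousLinearMap.nonneg_iff_isPositive K).mp hK).isSymmetric.restrict_invariant hV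
  have h0 : (K : H →ₗ[ℂ] H).restrict hV = 0 := by
    refine (hsym.eigenvectorBasis rfl).toBasis.ext fun i => ?_
    have h1 := hsym.apply_eigenvectorBasis rfl i
    set v := hsym.eigenvectorBasis rfl i with hv
    set μ := hsym.eigenvalues rfl i
    have hv0 : (v : H) ≠ 0 := by
      simpa using (hsym.eigenvectorBasis rfl).orthonormal.ne_zero i
    have h2 : K (v : H) = (μ : ℂ) • (v : H) := congrArg Subtype.val h1
    have h3 := h v v.2
    have h4 := re_inner_nonneg_of_nonneg hK v
    rw [h2, inner_smul_left, Complex.conj_ofReal, Complex.re_ofReal_mul] at h3 h4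
    have h5 : μ ≤ 0 := nonpos_of_mul_nonpos_left h3 (re_inner_pos hρ hu hv0)
    have h6 : 0 ≤ μ := by
      refine nonneg_of_mul_nonneg_left h4 ?_
      change 0 < RCLike.re (inner ℂ (v : H) v)
      rw [inner_self_eq_norm_sq]
      exact pow_pos (norm_pos_iff.mpr hv0) 2
    have h7 : μ = 0 := le_antisymm h5 h6
    simp only [OrthonormalBasis.coe_toBasis, LinearMap.zero_apply]
    rw [← hv, h1, h7]
    simp
  have := congrArg (fun f => ((f ⟨x, hx⟩ : V) : H)) h0
  simpa using this

theorem commute_of_mul_isSelfAdjoint {A N : H →L[ℂ] H} (hA : IsSelfAdjoint A)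
    (hN : IsSelfAdjoint N) (h : IsSelfAdjoint (A * N)) : Commute A N := by
  have := h.star_eq
  rw [star_mul, hA.star_eq, hN.star_eq] at this
  exact this.symm

theorem IsTwoSufficient.condExpTr_apply_eq {M₀ : StarSubalgebra ℂ (H →L[ℂ] H)}
    {ρ₀ ρ₁ : H →L[ℂ] H} (h2 : IsTwoSufficient M₀ ρ₀ ρ₁) (h₀ : IsInvertibleDensity ρ₀)
    (h₁ : IsInvertibleDensity ρ₁) {t : ℝ} (ht : 0 < t) {x : H} (hx : ρ₁ x = (t : ℂ) • ρ₀ x) :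
    (condExpTr M₀ ρ₁ : H →L[ℂ] H) x = (t : ℂ) • (condExpTr M₀ ρ₀ : H →L[ℂ] H) x := by
  have hs₀ := IsSelfAdjoint.of_nonneg h₀.nonneg
  have hs₁ := IsSelfAdjoint.of_nonneg h₁.nonneg
  have hu (c : ℝ) : Tendsto (fun k : ℕ => t + c / ((k : ℝ) + 2)) atTop (𝓝 t) := by
    have : Tendsto (fun k : ℕ => c / ((k : ℝ) + 2)) atTop (𝓝 0) :=
      tendsto_const_nhds.div_atTop (tendsto_atTop_add_const_right _ _ tendsto_natCast_atTop_atTop)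
    simpa using this.const_add t
  -- The shift by `2` keeps `t - t / (k + 2)` positive already at `k = 0`.
  obtain ⟨N, hNM, hN, hNA, hNl, -⟩ := h2.exists_limit_isTest hs₀ hs₁ (t := t)
    (s := fun k => t + -t / ((k : ℝ) + 2)) (fun k => by
      have : t / ((k : ℝ) + 2) < t := div_lt_self ht (by linarith [k.cast_nonneg (α := ℝ)])
      rw [neg_div]; linarith) (hu _)
  obtain ⟨R, hRM, hR, hRA, -, hRr⟩ := h2.exists_limit_isTest hs₀ hs₁ (t := t)
    (s := fun k => t + t / ((k : ℝ) + 2)) (fun k => by positivity) (hu _)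
  set A := ρ₁ - (t : ℂ) • ρ₀ with hAdef
  have hA : IsSelfAdjoint A := isSelfAdjoint_sub_smul hs₀ hs₁ t
  have hA' : IsSelfAdjoint A⁺ := .of_nonneg (CFC.posPart_nonneg A)
  have hAx : A x = 0 := sub_eq_zero.mpr hx
  have hNx : (1 - N) x = 0 := by
    refine apply_eq_zero_of_re_inner_nonpos h₀.nonneg h₀.isUnit (sub_nonneg.mpr hN.2) ?_
      (hNl fun k => ?_) hAx
    · exact (Commute.one_right _).sub_right
        (commute_of_mul_isSelfAdjoint hA (.of_nonneg hN.1) (hNA ▸ hA'))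
    · have : 0 < t / ((k : ℝ) + 2) := by positivity
      rw [neg_div]; linarith
  have hRx : R x = 0 := by
    refine apply_eq_zero_of_re_inner_nonpos h₀.nonneg h₀.isUnit hR.1 ?_ (hRr fun k => ?_) hAx
    · exact commute_of_mul_isSelfAdjoint hA (.of_nonneg hR.1) (hRA ▸ hA')
    · have : 0 < t / ((k : ℝ) + 2) := by positivity
      linarith
  -- `D` lies in `M₀`, is annihilated by `A` on the left and fixes `x`, so the module property of
  -- `E` gives `E(A) x = E(A) D x = 0`.
  let D : M₀ := ⟨N - R, sub_mem hNM hRM⟩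
  have hAD : A * (D : H →L[ℂ] H) = 0 := by simp [D, mul_sub, hNA, hRA]
  have hE := condExpTr_mul_right M₀ A D
  rw [hAD, map_zero, hAdef, map_sub, map_smul] at hE
  have hDx : (D : H →L[ℂ] H) x = x := by
    simp only [D, sub_apply, hRx, sub_zero]
    exact (sub_eq_zero.mp hNx).symm
  have h := congrArg (fun X : M₀ => (X : H →L[ℂ] H) x) hE
  simp only [ZeroMemClass.coe_zero, MulMemClass.coe_mul, mul_apply_eq_comp, hDx] at h
  exact sub_eq_zero.mp h.symm

theorem star_eq_self_of_mul_eq_one {R : Type*} [Monoid R] [StarMul R] {f g : R}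
    (hf : star f = f) (hgf : g * f = 1) : star g = g := by
  have h : f * star g = 1 := by
    conv_lhs => rw [← hf]
    rw [← star_mul, hgf, star_one]
  exact (left_inv_eq_right_inv hgf h).symm

/-- An operator is determined on the generalized eigenvectors of a definite hermitian pencil. -/
theorem eq_of_forall_generalized_eigenvector {ρ₀ ρ₁ B C : H →L[ℂ] H} (h₀ : 0 ≤ ρ₀)
    (hu₀ : IsUnit ρ₀) (h₁ : 0 ≤ ρ₁) (hu₁ : IsUnit ρ₁)
    (h : ∀ t : ℝ, 0 < t → ∀ x, ρ₁ x = (t : ℂ) • ρ₀ x → B x = C x) : B = C := by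
  obtain ⟨S, hS⟩ := (CFC.isUnit_sqrt_iff ρ₀ h₀).mpr hu₀
  have hSS : (S : H →L[ℂ] H) * S = ρ₀ := by rw [hS]; exact CFC.sqrt_mul_sqrt_self ρ₀ h₀
  set W : H →L[ℂ] H := ↑S⁻¹
  have hSsa : IsSelfAdjoint (S : H →L[ℂ] H) := by
    rw [hS]; exact .of_nonneg (CFC.sqrt_nonneg ρ₀)
  have hWsa : star W = W :=
    star_eq_self_of_mul_eq_one hSsa S.inv_mul
  have hd : 0 ≤ W * ρ₁ * W := by
    have := star_left_conjugate_nonneg h₁ W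
    rwa [hWsa] at this
  have hsym : ((W * ρ₁ * W : H →L[ℂ] H) : H →ₗ[ℂ] H).IsSymmetric :=
    ((ContinuousLinearMap.nonneg_iff_isPositive _).mp hd).isSymmetric
  -- With `W = ρ₀^(-1/2)`, an eigenvector `v` of `W ρ₁ W` gives the generalized eigenvector `W v` of
  -- the pencil with the same eigenvalue.
  have hBC : (B - C) * W = 0 := by
    refine ContinuousLinearMap.coe_injective ((hsym.eigenvectorBasis rfl).toBasis.ext fun i => ?_)
    have h1 := hsym.apply_eigenvectorBasis rfl i
    rw [OrthonormalBasis.coe_toBasis]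
    have hv0 : hsym.eigenvectorBasis rfl i ≠ 0 := (hsym.eigenvectorBasis rfl).orthonormal.ne_zero i
    generalize hsym.eigenvectorBasis rfl i = v at h1 hv0 ⊢
    generalize hsym.eigenvalues rfl i = t at h1
    have hSW : (S : H →L[ℂ] H) * W = 1 := by simp [W]
    have h2 : ρ₁ (W v) = (t : ℂ) • ρ₀ (W v) := by
      have h3 := congrArg (S : H →L[ℂ] H) h1
      have h4 : (S : H →L[ℂ] H) * (W * ρ₁ * W) = ρ₁ * W := by
        simp only [← mul_assoc, hSW, one_mul]
      have h5 : ρ₀ * W = S := by rw [← hSS, mul_assoc, hSW, mul_one]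
      have h6 := congrArg (fun X : H →L[ℂ] H => X v) h4
      have h7 := congrArg (fun X : H →L[ℂ] H => X v) h5
      simp only [mul_apply_eq_comp] at h6 h7
      rw [← h6, h7]
      simpa using h3
    have hWv : W v ≠ 0 := by
      intro h0
      have := congrArg (fun X : H →L[ℂ] H => X v) hSW
      simp only [mul_apply_eq_comp, h0, map_zero] at this
      exact hv0 this.symm
    have ht : 0 < t := by
      have h3 := re_inner_pos h₁ hu₁ hWv
      rw [h2, inner_smul_right, Complex.re_ofReal_mul] at h3
      exact pos_of_mul_pos_left h3 (re_inner_pos h₀ hu₀ hWv).le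
    have := h t ht _ h2
    simp [this]
  have h1 := congrArg (· * (S : H →L[ℂ] H)) hBC
  simp only [mul_assoc, W, Units.inv_mul, mul_one, zero_mul] at h1
  exact sub_eq_zero.mp h1

/-- Under 2-sufficiency, both pairs of densities have the same ratio, which is in `M₀`. -/
theorem IsTwoSufficient.exists_ratio {M₀ : StarSubalgebra ℂ (H →L[ℂ] H)}
    {ρ₀ ρ₁ : H →L[ℂ] H} (h2 : IsTwoSufficient M₀ ρ₀ ρ₁) (h₀ : IsInvertibleDensity ρ₀)
    (h₁ : IsInvertibleDensity ρ₁) :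
    ∃ a : M₀, ρ₁ = ρ₀ * (a : H →L[ℂ] H) ∧ condExpTr M₀ ρ₁ = condExpTr M₀ ρ₀ * a := by
  obtain ⟨u, hu⟩ := isUnit_condExpTr M₀ h₀.nonneg h₀.isUnit
  have hF : condExpTr M₀ ρ₁ = condExpTr M₀ ρ₀ * (↑u⁻¹ * condExpTr M₀ ρ₁) := by
    rw [← hu, Units.mul_inv_cancel_left]
  refine ⟨↑u⁻¹ * condExpTr M₀ ρ₁, ?_, hF⟩
  refine eq_of_forall_generalized_eigenvector h₀.nonneg h₀.isUnit h₁.nonneg h₁.isUnit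
    fun t ht x hx => ?_
  have h3 := h2.condExpTr_apply_eq h₀ h₁ ht hx
  have h4 : ((↑u⁻¹ : M₀) : H →L[ℂ] H) * (condExpTr M₀ ρ₀ : H →L[ℂ] H) = 1 := by
    rw [← MulMemClass.coe_mul, ← hu, Units.inv_mul, OneMemClass.coe_one]
  have h5 := congrArg (fun X : H →L[ℂ] H => X x) h4
  simp only [mul_apply_eq_comp] at h5
  simp only [MulMemClass.coe_mul, mul_apply_eq_comp, h3, map_smul, h5, hx]
  rfl

/-! ### Recovery maps -/

/-- The Petz map `X ↦ ρ₀^(1/2) E(ρ₀)^(-1/2) X E(ρ₀)^(-1/2) ρ₀^(1/2)` always returns `ρ₀`; it returns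
`ρ₁` because `a` commutes with both square roots. -/
theorem isSufficient_of_commute_ratio {M₀ : StarSubalgebra ℂ (H →L[ℂ] H)} {ρ₀ ρ₁ : H →L[ℂ] H}
    (h₀ : IsInvertibleDensity ρ₀) (a : M₀) (hρ : ρ₁ = ρ₀ * (a : H →L[ℂ] H))
    (hF : condExpTr M₀ ρ₁ = condExpTr M₀ ρ₀ * a) (hc : Commute ρ₀ (a : H →L[ℂ] H)) :
    IsSufficient M₀ ρ₀ ρ₁ := by
  have hF0 := condExpTr_nonneg M₀ h₀.nonneg
  -- `E(ρ₀) a = E(ρ₀ a) = E(a ρ₀) = a E(ρ₀)`.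
  have hFa : Commute (condExpTr M₀ ρ₀) a := by
    rw [commute_iff_eq, ← hF, hρ, hc.eq, condExpTr_mul_left]
  obtain ⟨f, hf⟩ := (CFC.isUnit_sqrt_iff _ hF0).mpr (isUnit_condExpTr M₀ h₀.nonneg h₀.isUnit)
  have hff : (f : M₀) * f = condExpTr M₀ ρ₀ := by rw [hf]; exact CFC.sqrt_mul_sqrt_self _ hF0
  have hfsa : star (f : M₀) = f := by
    rw [hf]; exact (IsSelfAdjoint.of_nonneg (CFC.sqrt_nonneg _)).star_eq
  have hfa : Commute (f : M₀) a := by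
    rw [hf]; exact hFa.cfcₙ_nnreal _
  set g : M₀ := ↑f⁻¹
  have hfg : (f : M₀) * g = 1 := f.mul_inv
  have hgf : g * (f : M₀) = 1 := f.inv_mul
  have hga : Commute g a := hfa.units_inv_left
  have hgsa : star g = g := star_eq_self_of_mul_eq_one hfsa hgf
  set R := CFC.sqrt ρ₀
  have hRR : R * R = ρ₀ := CFC.sqrt_mul_sqrt_self ρ₀ h₀.nonneg
  have hRsa : star R = R := (IsSelfAdjoint.of_nonneg (CFC.sqrt_nonneg ρ₀)).star_eq
  have hRa : Commute R (a : H →L[ℂ] H) := hc.cfcₙ_nnreal _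
  have hgsa' : star (g : H →L[ℂ] H) = g := congrArg Subtype.val hgsa
  have hconj (X : M₀) : R * (g : H →L[ℂ] H) * (X : H →L[ℂ] H) * star (R * (g : H →L[ℂ] H)) =
      R * ((g * X * g : M₀) : H →L[ℂ] H) * R := by
    rw [star_mul, hgsa', hRsa]
    simp only [MulMemClass.coe_mul, mul_assoc]
  have hgFg : g * condExpTr M₀ ρ₀ * g = 1 := by
    rw [← hff, ← mul_assoc, hgf, one_mul, hfg]
  refine isSufficient_of_conj (R * (g : H →L[ℂ] H)) (fun X => ?_) ?_ ?_
  · have h1 := opTrace_condExpTr_mul M₀ ρ₀ (g * X * g)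
    rw [star_mul, hgsa', hRsa]
    have h2 : g * (condExpTr M₀ ρ₀ * (g * X)) = X := by
      rw [← mul_assoc, ← mul_assoc, hgFg, one_mul]
    have h3 := congrArg Subtype.val h2
    simp only [MulMemClass.coe_mul] at h1 h3
    calc opTrace ((g : H →L[ℂ] H) * R * (R * (g : H →L[ℂ] H)) * (X : H →L[ℂ] H)) =
          opTrace ((g : H →L[ℂ] H) * (ρ₀ * ((g : H →L[ℂ] H) * (X : H →L[ℂ] H)))) := by
            rw [← hRR]; simp only [mul_assoc]
      _ = opTrace ((condExpTr M₀ ρ₀ : H →L[ℂ] H) * ((g : H →L[ℂ] H) * (X : H →L[ℂ] H) * (g : H →L[ℂ] H))) := by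
            rw [opTrace_mul_comm, mul_assoc, h1]
      _ = opTrace (X : H →L[ℂ] H) := by
            rw [← mul_assoc, opTrace_mul_comm, h3]
  · rw [hconj, hgFg, OneMemClass.coe_one, mul_one, hRR]
  · have : g * condExpTr M₀ ρ₁ * g = a := by
      rw [hF, ← mul_assoc, mul_assoc _ a, ← hga.eq, ← mul_assoc, hgFg, one_mul]
    rw [hconj, this, mul_assoc, ← hRa.eq, ← mul_assoc, hRR, hρ]

/-! ### Complex powers and modular invariance -/

theorem opCpow_one {ρ : H →L[ℂ] H} (hρ : 0 ≤ ρ) (hu : IsUnit ρ) : opCpow ρ 1 = ρ := by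
  rw [opCpow, one_smul]
  exact CFC.exp_log ρ (hu.isStrictlyPositive hρ)

theorem opCpow_neg_mul_self (ρ : H →L[ℂ] H) (z : ℂ) : opCpow ρ (-z) * opCpow ρ z = 1 := by
  let := NormedAlgebra.restrictScalars ℚ ℂ (H →L[ℂ] H)
  rw [opCpow, opCpow, ← NormedSpace.exp_add_of_commute
    (((Commute.refl _).smul_left _).smul_right _), ← add_smul]
  simp

theorem differentiable_opCpow (ρ : H →L[ℂ] H) : Differentiable ℂ (opCpow ρ) :=
  fun z => (hasDerivAt_exp_smul_const (CFC.log ρ) z).differentiableAt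

/-- Invariance under the modular group extends analytically to complex parameters. -/
theorem IsModularInvariant.opCpow_mul_mem {M₀ : StarSubalgebra ℂ (H →L[ℂ] H)} {ρ : H →L[ℂ] H}
    (h : IsModularInvariant M₀ ρ) {X : H →L[ℂ] H} (hX : X ∈ M₀) (z : ℂ) :
    opCpow ρ z * X * opCpow ρ (-z) ∈ M₀ := by
  by_contra hn
  -- A functional vanishing on `M₀` but not at the given point yields an entire function of the
  -- exponent that is zero at the points `i / (n + 1)`, which accumulate at `0`; the identity
  -- theorem makes it zero everywhere.
  obtain ⟨f, hf, hker⟩ := Submodule.exists_le_ker_of_notMem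
    (p := M₀.toSubalgebra.toSubmodule) (v := opCpow ρ z * X * opCpow ρ (-z)) hn
  let g : (H →L[ℂ] H) →L[ℂ] ℂ := LinearMap.toContinuousLinearMap f
  have hd : Differentiable ℂ fun w => g (opCpow ρ w * X * opCpow ρ (-w)) := by
    have h1 := differentiable_opCpow ρ
    have h2 : Differentiable ℂ fun w => opCpow ρ (-w) := h1.comp differentiable_neg
    exact g.differentiable.comp ((h1.mul_const X).mul h2)
  have han : AnalyticOnNhd ℂ (fun w => g (opCpow ρ w * X * opCpow ρ (-w))) Set.univ :=
    fun w _ => hd.analyticAt w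
  have hlim : Tendsto (fun n : ℕ => Complex.I * ((1 / ((n : ℝ) + 1) : ℝ) : ℂ)) atTop (𝓝[≠] 0) := by
    refine tendsto_nhdsWithin_iff.mpr ⟨?_, Eventually.of_forall fun n => ?_⟩
    · have := (Complex.continuous_ofReal.tendsto 0).comp
        (tendsto_one_div_add_atTop_nhds_zero_nat (𝕜 := ℝ))
      simpa using this.const_mul Complex.I
    · have : (n : ℝ) + 1 ≠ 0 := by positivity
      exact mul_ne_zero Complex.I_ne_zero (Complex.ofReal_ne_zero.mpr (one_div_ne_zero this))
  have hzero := han.eq_of_frequently_eq (g := fun _ => (0 : ℂ)) analyticOnNhd_const (z₀ := 0)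
    (hlim.frequently (Frequently.of_forall fun n => hker (h _ X hX)))
  exact hf (congrFun hzero z)

theorem isSufficient_of_isModularInvariant {M₀ : StarSubalgebra ℂ (H →L[ℂ] H)}
    {ρ₀ ρ₁ : H →L[ℂ] H} (h₀ : IsInvertibleDensity ρ₀) (a : M₀)
    (hρ : ρ₁ = ρ₀ * (a : H →L[ℂ] H)) (hF : condExpTr M₀ ρ₁ = condExpTr M₀ ρ₀ * a)
    (hmod : IsModularInvariant M₀ ρ₀) : IsSufficient M₀ ρ₀ ρ₁ := by
  obtain ⟨u, hu⟩ := isUnit_condExpTr M₀ h₀.nonneg h₀.isUnit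
  have hF0 := condExpTr_nonneg M₀ h₀.nonneg
  set G : M₀ := ↑u⁻¹
  have hGF : G * condExpTr M₀ ρ₀ = 1 := by rw [← hu, Units.inv_mul]
  have hFG : condExpTr M₀ ρ₀ * G = 1 := by rw [← hu, Units.mul_inv]
  have hFsa : star (condExpTr M₀ ρ₀) = condExpTr M₀ ρ₀ := (IsSelfAdjoint.of_nonneg hF0).star_eq
  have hGsa : star G = G := star_eq_self_of_mul_eq_one hFsa hGF
  have hG0 : 0 ≤ (G : H →L[ℂ] H) := by
    have h1 : 0 ≤ G * condExpTr M₀ ρ₀ * star G := star_right_conjugate_nonneg hF0 G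
    rwa [hGF, one_mul, hGsa] at h1
  set c : H →L[ℂ] H := (G : H →L[ℂ] H) * ρ₀ with hc
  -- Analytic continuation to the exponent `1` puts `Y = ρ₀ X ρ₀⁻¹` in `M₀`. Applying `E` to `Y ρ₀ =
  -- ρ₀ X` gives `Y E(ρ₀) = E(ρ₀) X`, so `ρ₀` and `E(ρ₀)` conjugate `X` alike.
  have hcX (X : M₀) : Commute c (X : H →L[ℂ] H) := by
    have hY := hmod.opCpow_mul_mem X.2 1
    set Y : M₀ := ⟨_, hY⟩ with hYdef
    have h1 : (Y : H →L[ℂ] H) * ρ₀ = ρ₀ * (X : H →L[ℂ] H) := by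
      have h2 := opCpow_neg_mul_self ρ₀ 1
      simp only [hYdef]
      rw [opCpow_one h₀.nonneg h₀.isUnit] at h2 ⊢
      rw [mul_assoc, h2, mul_one]
    have h2 : Y * condExpTr M₀ ρ₀ = condExpTr M₀ ρ₀ * X := by
      rw [← condExpTr_mul_left, h1, condExpTr_mul_right]
    have h3 : G * Y = X * G := by
      calc G * Y = G * (Y * condExpTr M₀ ρ₀) * G := by
            rw [mul_assoc, mul_assoc Y, hFG, mul_one]
        _ = X * G := by rw [h2, ← mul_assoc G, hGF, one_mul]
    have h4 : (G : H →L[ℂ] H) * (Y : H →L[ℂ] H) = (X : H →L[ℂ] H) * G := congrArg Subtype.val h3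
    rw [commute_iff_eq, hc, mul_assoc, ← h1, ← mul_assoc, h4, mul_assoc]
  have hFGc : (condExpTr M₀ ρ₀ : H →L[ℂ] H) * G = 1 := congrArg Subtype.val hFG
  have hFc : (condExpTr M₀ ρ₀ : H →L[ℂ] H) * c = ρ₀ := by rw [hc, ← mul_assoc, hFGc, one_mul]
  -- Multiplying `c G = G c` on the left by `E(ρ₀)` gives `ρ₀ G = c = G ρ₀`; thus `c` is a product
  -- of commuting positive operators.
  have hcomm : Commute (G : H →L[ℂ] H) ρ₀ := by
    have h1 := (hcX G).eq
    have h2 := congrArg (fun Z => (condExpTr M₀ ρ₀ : H →L[ℂ] H) * Z) h1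
    simp only [← mul_assoc, hFc, hFGc, one_mul] at h2
    rw [commute_iff_eq, ← hc, ← h2]
  have hc0 : 0 ≤ c := Commute.mul_nonneg hG0 h₀.nonneg hcomm
  set S := CFC.sqrt c
  have hSS : S * S = c := CFC.sqrt_mul_sqrt_self c hc0
  have hSsa : star S = S := (IsSelfAdjoint.of_nonneg (CFC.sqrt_nonneg c)).star_eq
  have hSX (X : M₀) : S * (X : H →L[ℂ] H) * star S = (X : H →L[ℂ] H) * c := by
    have : Commute S (X : H →L[ℂ] H) := (hcX X).cfcₙ_nnreal _
    rw [hSsa, this.eq, mul_assoc, hSS]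
  refine isSufficient_of_conj S (fun X => ?_) ?_ ?_
  · rw [hSsa, hSS, (hcX X).eq, hc, ← mul_assoc, opTrace_mul_comm]
    have h1 := opTrace_condExpTr_mul M₀ ρ₀ (X * G)
    rw [MulMemClass.coe_mul] at h1
    rw [← h1, ← mul_assoc, opTrace_mul_comm, ← mul_assoc]
    rw [show (G : H →L[ℂ] H) * (condExpTr M₀ ρ₀ : H →L[ℂ] H) = 1 from congrArg Subtype.val hGF,
      one_mul]
  · rw [hSX, hFc]
  · rw [hSX, hF, MulMemClass.coe_mul, mul_assoc, ← (hcX a).eq, ← mul_assoc, hFc, hρ]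

end

theorem mainTheorem1 {H : Type*} [NormedAddCommGroup H] [InnerProductSpace ℂ H]
    [FiniteDimensional ℂ H] [CompleteSpace H] (ρ₀ ρ₁ : H →L[ℂ] H)
    (hρ₀ : IsInvertibleDensity ρ₀) (hρ₁ : IsInvertibleDensity ρ₁)
    (M₀ : StarSubalgebra ℂ (H →L[ℂ] H)) (h2 : IsTwoSufficient M₀ ρ₀ ρ₁) :
    (IsModularInvariant M₀ ρ₀ → IsSufficient M₀ ρ₀ ρ₁) ∧
    ((∀ X ∈ M₀, ∀ Y ∈ M₀, X * Y = Y * X) → IsSufficient M₀ ρ₀ ρ₁) ∧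
    (ρ₀ * ρ₁ = ρ₁ * ρ₀ → IsSufficient M₀ ρ₀ ρ₁) := by
  obtain ⟨a, hρ, hF⟩ := h2.exists_ratio hρ₀ hρ₁
  have hs₀ := IsSelfAdjoint.of_nonneg hρ₀.nonneg
  have hs₁ := IsSelfAdjoint.of_nonneg hρ₁.nonneg
  refine ⟨isSufficient_of_isModularInvariant hρ₀ a hρ hF, fun hcomm => ?_, fun hcomm => ?_⟩
  · refine isSufficient_of_commute_ratio hρ₀ a hρ hF ?_
    have hF₀ := (IsSelfAdjoint.of_nonneg (condExpTr_nonneg M₀ hρ₀.nonneg)).star_eq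
    have hF₁ := (IsSelfAdjoint.of_nonneg (condExpTr_nonneg M₀ hρ₁.nonneg)).star_eq
    -- Adjoints in `E(ρ₁) = E(ρ₀) a` give `a⋆ E(ρ₀) = E(ρ₀) a`; commutativity and cancellation leave
    -- `a⋆ = a`. Then `ρ₁ = ρ₀ a` is a self-adjoint product of self-adjoint factors, which therefore
    -- commute.
    have ha : star a = a := by
      have h1 := congrArg star hF
      rw [star_mul, hF₀, hF₁, hF] at h1
      refine (isUnit_condExpTr M₀ hρ₀.nonneg hρ₀.isUnit).mul_right_injective ?_
      change condExpTr M₀ ρ₀ * star a = condExpTr M₀ ρ₀ * a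
      rw [h1]
      exact Subtype.ext (hcomm _ (condExpTr M₀ ρ₀).2 _ (star a).2)
    exact commute_of_mul_isSelfAdjoint hs₀ (congrArg Subtype.val ha) (hρ ▸ hs₁)
  · refine isSufficient_of_commute_ratio hρ₀ a hρ hF ?_
    -- After left multiplication by `ρ₀`, the claim `ρ₀ a = a ρ₀` reads `ρ₀ ρ₁ = ρ₁ ρ₀`.
    refine hρ₀.isUnit.mul_right_injective ?_
    change ρ₀ * (ρ₀ * (a : H →L[ℂ] H)) = ρ₀ * (a * ρ₀)
    rw [← mul_assoc ρ₀ _ ρ₀, ← hρ, hcomm]
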